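/- For an integer $r\ge 1$ let $S_r=\mathbb R/r\mathbb Z$ and $S^1=S_1$. A homeomorphism between two such circles is *piecewise linear* (PL) if there is a finite subdivision of the source circle such that a lift to $\mathbb R$ is affine on each interval of the subdivision; $PL^+(S_r)$ is the group of orientation-preserving PL homeomorphisms of $S_r$ (all slopes positive). Let $p\ge 3$ and let $1<n_1<\dots<n_p$ be integers such that $\log n_1,\dots,\log n_p$ are linearly independent over $\mathbb Q$. Let $\Lambda=\langle n_1,\dots,n_p\rangle\subset\mathbb R_{>0}$ be the multiplicative group that they generate and let $A=\mathbb Z[\frac1{n_1},\dots,\frac1{n_p}]$. The Thompson–Stein group $G=T_{r,(n_i)}$ is the group of all $f\in PL^+(S_r)$ for which there is a subdivision $0=a_0<a_1<\dots<a_k=r$ with all $a_j\in A$ such that a lift $\tilde f$ of $f$ satisfies $\tilde f(a_j)\in A$ for all $j$ and is affine with slope in $\Lambda$ on each $[a_{j-1},a_j]$. The standard representation of $G$ is its inclusion in $PL^+(S_r)$. Let $\phi: G\to PL^+(S^1)$ be a group homomorphism that is topologically conjugate to the standard representation: there is a homeomorphism $h:S_r\to S^1$ (not necessarily orientation-preserving)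 with $\phi(g)=h\circ g\circ h^{-1}$ for all $g\in G$. Then $\phi$ is PL-conjugate to the standard representation: there is a PL homeomorphism $H:S_r\to S^1$ (not necessarily orientation-preserving) with $\phi(g)=H\circ g\circ H^{-1}$ for all $g\in G$. -/

import Mathlib

/-! Piecewise linear homeomorphisms of the circles `S_r = ℝ / r ℤ` (`AddCircle r`) and the
Thompson-Stein groups. -/

namespace ThompsonStein

/-- The homeomorphism `F` of the real line is a lift of the homeomorphism `f : S_r → S_s`.
(Every homeomorphism between circles has such a lift.) -/
def IsLift {r s : ℝ} (f : AddCircle r ≃ₜ AddCircle s) (F : ℝ ≃ₜ ℝ) : Prop :=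
  ∀ x : ℝ, f (x : AddCircle r) = ((F x : ℝ) : AddCircle s)

/-- `F` is affine, with slope in `Λ`, on each closed interval whose interior contains no
(representative of a) point of `B ⊆ S_r`. For a finite `B` this says that the points of `B`
subdivide the circle into finitely many arcs on each of which `F x = l x + c`, with `l ∈ Λ`. -/
def AffineOff {r : ℝ} (Λ : Set ℝ) (B : Set (AddCircle r)) (F : ℝ → ℝ) : Prop :=
  ∀ x y : ℝ, x < y → (∀ z ∈ Set.Ioo x y, (z : AddCircle r) ∉ B) →
    ∃ l ∈ Λ, ∃ c : ℝ, ∀ z ∈ Set.Icc x y, F z = l * z + c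

/-- Piecewise linear homeomorphisms `S_r → S_s` (of either orientation). -/
def IsPL {r s : ℝ} (f : AddCircle r ≃ₜ AddCircle s) : Prop :=
  ∃ F : ℝ ≃ₜ ℝ, IsLift f F ∧ ∃ B : Set (AddCircle r), B.Finite ∧ AffineOff Set.univ B F

/-- Orientation preserving PL homeomorphisms: all slopes are positive. -/
def IsPLPlus {r s : ℝ} (f : AddCircle r ≃ₜ AddCircle s) : Prop :=
  ∃ F : ℝ ≃ₜ ℝ, IsLift f F ∧ ∃ B : Set (AddCircle r), B.Finite ∧ AffineOff (Set.Ioi 0) B F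

/-- Membership in `T_{r,Λ,A}`: slopes in `Λ`, breaks and their images in `A`. The base point `0`
always counts as one of the subdivision points, so that its image lies in `A` too. -/
def MemT (r : ℝ) (Λ : Subgroup {x : ℝ // 0 < x}) (A : AddSubgroup ℝ)
    (f : AddCircle r ≃ₜ AddCircle r) : Prop :=
  ∃ F : ℝ ≃ₜ ℝ, IsLift f F ∧ ∃ B : Set (AddCircle r), B.Finite ∧ 0 ∈ B ∧
    (∀ x : ℝ, (x : AddCircle r) ∈ B → x ∈ A ∧ F x ∈ A) ∧
    AffineOff (Subtype.val '' (Λ : Set {x : ℝ // 0 < x})) B F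

/-! ### These sets of homeomorphisms are groups -/

theorem strictMono_of_affineOff {r : ℝ} (hr : 0 < r) {Λ : Set ℝ} (hΛ : ∀ l ∈ Λ, 0 < l)
    {B : Set (AddCircle r)} (hB : B.Finite) {F : ℝ ≃ₜ ℝ} (h : AffineOff Λ B F) :
    StrictMono F := by
  rcases F.continuous.strictMono_of_inj F.injective with h1 | h1
  · exact h1
  exfalso
  have _i : Fact (0 < r) := ⟨hr⟩
  have hinf : Infinite (AddCircle r) := by
    have : Infinite (Set.Ico (0 : ℝ) (0 + r)) := (Set.Ico_infinite (by linarith)).to_subtype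
    exact Infinite.of_injective _ (AddCircle.equivIco r 0).symm.injective
  obtain ⟨q, hq⟩ := hB.exists_notMem
  obtain ⟨x, rfl⟩ := QuotientAddGroup.mk_surjective q
  have hop : IsOpen {z : ℝ | (z : AddCircle r) ∉ B} :=
    hB.isClosed.isOpen_compl.preimage (AddCircle.continuous_mk' r)
  obtain ⟨e, he, hb⟩ := Metric.isOpen_iff.1 hop x hq
  obtain ⟨l, hl, c, hF⟩ := h x (x + e) (by linarith) (fun z hz => hb (by
    rw [Metric.mem_ball, Real.dist_eq, abs_of_pos (by linarith [hz.1])]; linarith [hz.2]))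
  have h2 := h1 (show x < x + e by linarith)
  rw [hF x ⟨le_rfl, by linarith⟩, hF (x + e) ⟨by linarith, le_rfl⟩] at h2
  nlinarith [mul_pos (hΛ l hl) he]

theorem AffineOff.comp {r : ℝ} {Λ : Set ℝ} (hmul : ∀ l ∈ Λ, ∀ l' ∈ Λ, l * l' ∈ Λ)
    {g : AddCircle r ≃ₜ AddCircle r} {F G : ℝ ≃ₜ ℝ} (hg : IsLift g G)
    (hGm : StrictMono G) {B C : Set (AddCircle r)} (h : AffineOff Λ B F) (h' : AffineOff Λ C G) :
    AffineOff Λ (C ∪ g ⁻¹' B) (fun x => F (G x)) := by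
  intro x y hxy hz
  obtain ⟨l', hl', c', hG⟩ := h' x y hxy (fun z hz' hC => hz z hz' (Or.inl hC))
  obtain ⟨l, hl, c, hF⟩ := h (G x) (G y) (hGm hxy) (fun z hz' hB => by
    obtain ⟨w, rfl⟩ := G.surjective z
    refine hz w ⟨hGm.lt_iff_lt.1 hz'.1, hGm.lt_iff_lt.1 hz'.2⟩ (Or.inr ?_)
    rw [Set.mem_preimage, hg w]; exact hB)
  refine ⟨l * l', hmul l hl l' hl', l * c' + c, fun z hz' => ?_⟩
  change F (G z) = _
  rw [hF (G z) ⟨hGm.monotone hz'.1, hGm.monotone hz'.2⟩, hG z hz']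
  ring

theorem AffineOff.inv {r : ℝ} {Λ : Set ℝ} (hΛ : ∀ l ∈ Λ, 0 < l) (hinv : ∀ l ∈ Λ, l⁻¹ ∈ Λ)
    {f : AddCircle r ≃ₜ AddCircle r} {F : ℝ ≃ₜ ℝ} (hf : IsLift f F)
    (hFm : StrictMono F) {B : Set (AddCircle r)} (h : AffineOff Λ B F) :
    AffineOff Λ (f '' B) F.symm := by
  have key : ∀ x y : ℝ, F.symm x < y ↔ x < F y := fun x y => by
    rw [← hFm.lt_iff_lt, F.apply_symm_apply]
  have key2 : ∀ x y : ℝ, x < F.symm y ↔ F x < y := fun x y => by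
    rw [← hFm.lt_iff_lt, F.apply_symm_apply]
  intro x y hxy hz
  obtain ⟨l, hl, c, hF⟩ := h (F.symm x) (F.symm y) (by rw [key, F.apply_symm_apply]; exact hxy)
    (fun z hz' hB => hz (F z) ⟨(key _ _).1 hz'.1, (key2 _ _).1 hz'.2⟩
      (by rw [← hf z]; exact Set.mem_image_of_mem f hB))
  have hl0 : l ≠ 0 := (hΛ l hl).ne'
  refine ⟨l⁻¹, hinv l hl, - (l⁻¹ * c), fun z hz' => ?_⟩
  have := hF (F.symm z) ⟨by rw [← not_lt, key, F.apply_symm_apply]; exact not_lt.2 hz'.1,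
    by rw [← not_lt, key, F.apply_symm_apply]; exact not_lt.2 hz'.2⟩
  rw [F.apply_symm_apply] at this
  field_simp
  linarith

/-- An element of `T_{r,Λ,A}` preserves the set of points of `A`. -/
theorem mem_iff_of_affineOff {r : ℝ} (hr : 0 < r) {Λ : Subgroup {x : ℝ // 0 < x}}
    {A : AddSubgroup ℝ} (hA : ∀ l ∈ Λ, ∀ a ∈ A, (l : ℝ) * a ∈ A)
    {F : ℝ ≃ₜ ℝ} {B : Set (AddCircle r)} (hB : B.Finite) (h0 : 0 ∈ B)
    (hBA : ∀ x : ℝ, (x : AddCircle r) ∈ B → x ∈ A ∧ F x ∈ A)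
    (h : AffineOff (Subtype.val '' (Λ : Set {x : ℝ // 0 < x})) B F) (a : ℝ) :
    F a ∈ A ↔ a ∈ A := by
  have _i : Fact (0 < r) := ⟨hr⟩
  have hcl : IsClosed {z : ℝ | (z : AddCircle r) ∈ B} :=
    hB.isClosed.preimage (AddCircle.continuous_mk' r)
  have hcpt : IsCompact (Set.Icc (a - r) a ∩ {z : ℝ | (z : AddCircle r) ∈ B}) :=
    isCompact_Icc.inter_right hcl
  have hne : (Set.Icc (a - r) a ∩ {z : ℝ | (z : AddCircle r) ∈ B}).Nonempty := by
    refine ⟨toIcoMod hr (a - r) 0, ⟨left_le_toIcoMod _ _ _, ?_⟩, ?_⟩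
    · have := toIcoMod_lt_right hr (a - r) 0
      linarith
    · have : ((toIcoMod hr (a - r) 0 : ℝ) : AddCircle r) = 0 := by
        rw [AddCircle.coe_eq_zero_iff]
        refine ⟨- toIcoDiv hr (a - r) 0, ?_⟩
        rw [toIcoMod, zsmul_eq_mul, zsmul_eq_mul]; push_cast; ring
      rw [Set.mem_ofPred_eq, this]; exact h0
  obtain ⟨b, ⟨hb1, hb2⟩, hb3⟩ := hcpt.exists_isGreatest hne
  obtain ⟨hbA, hFbA⟩ := hBA b hb2
  rcases hb1.2.eq_or_lt with rfl | hlt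
  · exact ⟨fun _ => hbA, fun _ => hFbA⟩
  obtain ⟨_, ⟨l, hl, rfl⟩, c, hF⟩ := h b a hlt (fun z hz hzB =>
    absurd (hb3 ⟨⟨hb1.1.trans hz.1.le, hz.2.le⟩, hzB⟩) (not_le.2 hz.1))
  have e : F a = F b + l * (a - b) := by
    rw [hF a ⟨hlt.le, le_rfl⟩, hF b ⟨le_rfl, hlt.le⟩]; ring
  constructor
  · intro ha
    have h1 : (l : ℝ) * (a - b) ∈ A := by
      have := A.sub_mem ha hFbA
      rwa [e, add_sub_cancel_left] at this
    have h2 := hA l⁻¹ (Λ.inv_mem hl) _ h1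
    have hl0 : (l : ℝ) ≠ 0 := l.2.ne'
    have h3 : ((l⁻¹ : {x : ℝ // 0 < x}) : ℝ) * ((l : ℝ) * (a - b)) = a - b := by
      rw [Positive.coe_inv]; field_simp
    rw [h3] at h2
    have := A.add_mem h2 hbA
    rwa [sub_add_cancel] at this
  · intro ha
    rw [e]
    exact A.add_mem hFbA (hA l hl _ (A.sub_mem ha hbA))

theorem memT_one {r : ℝ} {Λ : Subgroup {x : ℝ // 0 < x}} {A : AddSubgroup ℝ} (hrA : r ∈ A) :
    MemT r Λ A 1 := by
  refine ⟨Homeomorph.refl ℝ, fun x => rfl, {0}, Set.finite_singleton _, rfl, fun x hx => ?_,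
    fun x y _ _ => ⟨1, ⟨1, Λ.one_mem, rfl⟩, 0, fun z _ => by simp⟩⟩
  rw [Set.mem_singleton_iff, AddCircle.coe_eq_zero_iff] at hx
  obtain ⟨k, rfl⟩ := hx
  exact ⟨A.zsmul_mem hrA k, A.zsmul_mem hrA k⟩

theorem MemT.mul {r : ℝ} (hr : 0 < r) {Λ : Subgroup {x : ℝ // 0 < x}} {A : AddSubgroup ℝ}
    (hA : ∀ l ∈ Λ, ∀ a ∈ A, (l : ℝ) * a ∈ A) {f g : AddCircle r ≃ₜ AddCircle r}
    (hf : MemT r Λ A f) (hg : MemT r Λ A g) : MemT r Λ A (f * g) := by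
  obtain ⟨F, hF, B, hB, h0, hBA, hFB⟩ := hf
  obtain ⟨G, hG, C, hC, h0', hCA, hGC⟩ := hg
  have hpos : ∀ l ∈ (Subtype.val '' (Λ : Set {x : ℝ // 0 < x})), 0 < l := by
    rintro _ ⟨l, _, rfl⟩; exact l.2
  have iF := mem_iff_of_affineOff hr hA hB h0 hBA hFB
  have iG := mem_iff_of_affineOff hr hA hC h0' hCA hGC
  refine ⟨G.trans F, fun x => ?_, C ∪ g ⁻¹' B, hC.union (hB.preimage g.injective.injOn),
    Or.inl h0', fun x hx => ?_, ?_⟩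
  · change f (g x) = _
    rw [hG x, hF (G x)]; rfl
  · have hx' : x ∈ A := by
      rcases hx with hx | hx
      · exact (hCA x hx).1
      · rw [Set.mem_preimage, hG x] at hx
        exact (iG x).1 (hBA _ hx).1
    exact ⟨hx', (iF _).2 ((iG x).2 hx')⟩
  · refine AffineOff.comp ?_ hG (strictMono_of_affineOff hr hpos hC hGC) hFB hGC
    rintro _ ⟨l, hl, rfl⟩ _ ⟨l', hl', rfl⟩
    exact ⟨l * l', Λ.mul_mem hl hl', rfl⟩

theorem MemT.inv {r : ℝ} (hr : 0 < r) {Λ : Subgroup {x : ℝ // 0 < x}} {A : AddSubgroup ℝ}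
    (hrA : r ∈ A) (hA : ∀ l ∈ Λ, ∀ a ∈ A, (l : ℝ) * a ∈ A) {f : AddCircle r ≃ₜ AddCircle r}
    (hf : MemT r Λ A f) : MemT r Λ A f⁻¹ := by
  obtain ⟨F, hF, B, hB, h0, hBA, hFB⟩ := hf
  have hpos : ∀ l ∈ (Subtype.val '' (Λ : Set {x : ℝ // 0 < x})), 0 < l := by
    rintro _ ⟨l, _, rfl⟩; exact l.2
  have iF := mem_iff_of_affineOff hr hA hB h0 hBA hFB
  have hFm := strictMono_of_affineOff hr hpos hB hFB
  have hlift : IsLift f⁻¹ F.symm := fun x => by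
    change f.symm x = _
    rw [f.symm_apply_eq, hF, F.apply_symm_apply]
  have hinv : AffineOff (Subtype.val '' (Λ : Set {x : ℝ // 0 < x})) (f '' B) F.symm := by
    refine AffineOff.inv hpos ?_ hF hFm hFB
    rintro _ ⟨l, hl, rfl⟩
    exact ⟨l⁻¹, Λ.inv_mem hl, rfl⟩
  refine ⟨F.symm, hlift, f '' B ∪ {0}, (hB.image f).union (Set.finite_singleton _), Or.inr rfl,
    fun x hx => ?_, fun x y hxy hz => hinv x y hxy (fun z hz' h => hz z hz' (Or.inl h))⟩
  have hx' : x ∈ A := by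
    rcases hx with ⟨q, hq, e⟩ | hx
    · have e' : q = ((F.symm x : ℝ) : AddCircle r) := by
        rw [← hlift x, ← e]; exact (f.symm_apply_apply q).symm
      rw [e'] at hq
      have := (hBA _ hq).2
      rwa [F.apply_symm_apply] at this
    · rw [Set.mem_singleton_iff, AddCircle.coe_eq_zero_iff] at hx
      obtain ⟨k, rfl⟩ := hx
      exact A.zsmul_mem hrA k
  refine ⟨hx', (iF _).1 ?_⟩
  rwa [F.apply_symm_apply]

theorem isPLPlus_iff {r : ℝ} (f : AddCircle r ≃ₜ AddCircle r) :
    IsPLPlus f ↔ MemT r ⊤ ⊤ f := by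
  have e : (Subtype.val '' ((⊤ : Subgroup {x : ℝ // 0 < x}) : Set {x : ℝ // 0 < x})) =
      Set.Ioi 0 := by
    ext x; simp
  constructor
  · rintro ⟨F, hF, B, hB, h⟩
    refine ⟨F, hF, B ∪ {0}, hB.union (Set.finite_singleton _), Or.inr rfl,
      fun x _ => ⟨AddSubgroup.mem_top _, AddSubgroup.mem_top _⟩, ?_⟩
    rw [e]
    exact fun x y hxy hz => h x y hxy (fun z hz' h' => hz z hz' (Or.inl h'))
  · rintro ⟨F, hF, B, hB, -, -, h⟩
    rw [e] at h
    exact ⟨F, hF, B, hB, h⟩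

/-- The group `PL⁺(S_r)`, for `r > 0`. -/
def PLPlus (r : ℝ) (hr : 0 < r) : Subgroup (AddCircle r ≃ₜ AddCircle r) where
  carrier := {f | IsPLPlus f}
  one_mem' := (isPLPlus_iff _).2 (memT_one (AddSubgroup.mem_top _))
  mul_mem' ha hb := (isPLPlus_iff _).2
    (MemT.mul hr (fun _ _ _ _ => AddSubgroup.mem_top _) ((isPLPlus_iff _).1 ha)
      ((isPLPlus_iff _).1 hb))
  inv_mem' ha := (isPLPlus_iff _).2
    (MemT.inv hr (AddSubgroup.mem_top _) (fun _ _ _ _ => AddSubgroup.mem_top _)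
      ((isPLPlus_iff _).1 ha))

/-- The group `T_{r,Λ,A}`, for a multiplicative group `Λ` of positive reals and an additive group
`A` of reals with `Λ A ⊆ A` and `r ∈ A`. -/
def T (r : ℝ) (hr : 0 < r) (Λ : Subgroup {x : ℝ // 0 < x}) (A : AddSubgroup ℝ)
    (hrA : r ∈ A) (hA : ∀ l ∈ Λ, ∀ a ∈ A, (l : ℝ) * a ∈ A) :
    Subgroup (AddCircle r ≃ₜ AddCircle r) where
  carrier := {f | MemT r Λ A f}
  one_mem' := memT_one hrA
  mul_mem' ha hb := MemT.mul hr hA ha hb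
  inv_mem' ha := MemT.inv hr hrA hA ha

/-! ### Thompson-Stein groups -/

/-- The multiplicative group generated by the `n i`. -/
noncomputable def slopeGroup {p : ℕ} (n : Fin p → ℕ) : Subgroup {x : ℝ // 0 < x} :=
  Subgroup.closure {l | ∃ i, (l : ℝ) = n i}

/-- The additive group of the ring `ℤ[1/n₁, …, 1/n_p]`. -/
noncomputable def breakGroup {p : ℕ} (n : Fin p → ℕ) : AddSubgroup ℝ :=
  (Algebra.adjoin ℤ (Set.range fun i => ((n i : ℝ))⁻¹)).toSubring.toAddSubgroup

theorem natCast_mem_breakGroup {p : ℕ} (n : Fin p → ℕ) (k : ℕ) : (k : ℝ) ∈ breakGroup n :=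
  natCast_mem (Algebra.adjoin ℤ (Set.range fun i => ((n i : ℝ))⁻¹)) k

theorem slopeGroup_mul_mem {p : ℕ} (n : Fin p → ℕ) :
    ∀ l ∈ slopeGroup n, ∀ a ∈ breakGroup n, (l : ℝ) * a ∈ breakGroup n := by
  suffices h : ∀ l ∈ slopeGroup n,
      (l : ℝ) ∈ Algebra.adjoin ℤ (Set.range fun i => ((n i : ℝ))⁻¹) ∧
      (l : ℝ)⁻¹ ∈ Algebra.adjoin ℤ (Set.range fun i => ((n i : ℝ))⁻¹) from
    fun l hl a ha => Subalgebra.mul_mem _ (h l hl).1 ha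
  intro l hl
  induction hl using Subgroup.closure_induction with
  | mem l hl =>
    obtain ⟨i, hi⟩ := hl
    rw [hi]
    exact ⟨natCast_mem _ _, Algebra.subset_adjoin ⟨i, rfl⟩⟩
  | one => simp
  | mul l l' _ _ h h' =>
    rw [Positive.val_mul, mul_inv]
    exact ⟨Subalgebra.mul_mem _ h.1 h'.1, Subalgebra.mul_mem _ h.2 h'.2⟩
  | inv l _ h =>
    rw [Positive.coe_inv, inv_inv]
    exact ⟨h.2, h.1⟩

/-- The Thompson-Stein group `T_{r,(n_i)}`, acting on `S_r`; its inclusion in the group of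
homeomorphisms of `S_r` is the standard representation. -/
noncomputable def thompsonStein (r : ℕ) (hr : 0 < r) {p : ℕ} (n : Fin p → ℕ) :
    Subgroup (AddCircle (r : ℝ) ≃ₜ AddCircle (r : ℝ)) :=
  T (r : ℝ) (Nat.cast_pos.2 hr) (slopeGroup n) (breakGroup n) (natCast_mem_breakGroup n r)
    (slopeGroup_mul_mem n)

/-- The homeomorphism `h : S_r → S^1` conjugates the standard representation of `T_{r,(n_i)}` to
`φ`, that is `φ g = h ∘ g ∘ h⁻¹` for all `g`. -/
def Conjugates {r : ℕ} {hr : 0 < r} {p : ℕ} {n : Fin p → ℕ}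
    (h : AddCircle (r : ℝ) ≃ₜ AddCircle (1 : ℝ))
    (φ : thompsonStein r hr n →* PLPlus 1 one_pos) : Prop :=
  ∀ (g : thompsonStein r hr n) (x : AddCircle (1 : ℝ)),
    (φ g : AddCircle (1 : ℝ) ≃ₜ AddCircle (1 : ℝ)) x =
      h ((g : AddCircle (r : ℝ) ≃ₜ AddCircle (r : ℝ)) (h.symm x))

end ThompsonStein

namespace ThompsonStein

open Filter Topology

/-! The given conjugacy `h` is itself PL. Let `H` be a lift of `h` to the line. Each `g` in the
group is carried by `h` to a PL map, so a lift `F` of `g` satisfies `H ∘ F = Φ ∘ H` with `Φ`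
piecewise linear. Two kinds of elements suffice: rotations by points of the dense group `A =
breakGroup n`, and elements fixing `0` with slope `n i` on its right.

Take `H` increasing and put `K x = H x - H 0`. The second kind gives `K (n i * x) = μ i * K x` for
small `x ≥ 0`. In logarithmic coordinates, after subtracting a linear term, this is a function on a
half-line with one period and one quasi-period that are incommensurable; it must be constant
(`constant_of_periods`), so `K x = C * x ^ α` near `0` on the right (`eq_rpow_of_homogeneous`). A
small rotation by `t` makes `(x + t) ^ α` an affine function of `x ^ α`, which forces `α = 1`
(`exponent_eq_one`). Thus `H` is affine on some `(0, ε)`, and rotations by the dense group `A`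
spread one-sided affinity to every point (`locallyPL_of_semiconj_of_strictMono`). Compactness of a
period leaves finitely many breaks (`exists_affineOff_of_locallyPL`). -/

/-! ### Germs of affine maps -/

/-- `F` agrees with an affine map along the filter `l`. -/
def AffineNear (F : ℝ → ℝ) (l : Filter ℝ) : Prop :=
  ∃ m c : ℝ, ∀ᶠ z in l, F z = m * z + c

/-- `F` is affine on one-sided neighbourhoods of every point. -/
def LocallyPL (F : ℝ → ℝ) : Prop :=
  ∀ y, AffineNear F (𝓝[≥] y) ∧ AffineNear F (𝓝[≤] y)

theorem AffineNear.mono {F : ℝ → ℝ} {l l' : Filter ℝ} (h : AffineNear F l) (hl : l' ≤ l) :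
    AffineNear F l' := by
  obtain ⟨m, c, h⟩ := h
  exact ⟨m, c, hl h⟩

theorem AffineNear.comp {F G : ℝ → ℝ} {l l' : Filter ℝ} (hF : AffineNear F l')
    (hG : AffineNear G l) (ht : Tendsto G l l') : AffineNear (fun x => F (G x)) l := by
  obtain ⟨m, c, hF⟩ := hF
  obtain ⟨m', c', hG⟩ := hG
  refine ⟨m * m', m * c' + c, ?_⟩
  filter_upwards [hG, ht.eventually hF] with z h1 h2
  rw [h2, h1]
  ring

theorem AffineNear.affine_comp {F : ℝ → ℝ} {l : Filter ℝ} (hF : AffineNear F l) (a b : ℝ) :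
    AffineNear (fun x => a * F x + b) l := by
  obtain ⟨m, c, hF⟩ := hF
  refine ⟨a * m, a * c + b, ?_⟩
  filter_upwards [hF] with z h
  rw [h]
  ring

theorem LocallyPL.affine_comp {F : ℝ → ℝ} (hF : LocallyPL F) (a b : ℝ) :
    LocallyPL (fun x => a * F x + b) := fun y =>
  ⟨(hF y).1.affine_comp a b, (hF y).2.affine_comp a b⟩

theorem LocallyPL.comp_neg {F : ℝ → ℝ} (hF : LocallyPL F) : LocallyPL (fun x => F (-x)) := by
  have hn : ∀ l, AffineNear (fun x : ℝ => -x) l := fun l => ⟨-1, 0, by simp⟩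
  refine fun y => ⟨(hF (-y)).2.comp (hn _) ?_, (hF (-y)).1.comp (hn _) ?_⟩
  · exact tendsto_neg_nhdsGE
  · exact tendsto_neg_nhdsLE

/-- The representatives of a finite set of classes are isolated, so each point has a punctured
neighbourhood free of breaks. The point itself may be a break, hence the one-sided germs. -/
theorem locallyPL_of_affineOff {r : ℝ} (hr : 0 < r) {Λ : Set ℝ} {B : Set (AddCircle r)}
    (hB : B.Finite) {F : ℝ → ℝ} (h : AffineOff Λ B F) : LocallyPL F := by
  have _i : Fact (0 < r) := ⟨hr⟩
  have key : ∀ y : ℝ, ∃ e > 0, ∀ z, z ≠ y → |z - y| < e → (z : AddCircle r) ∉ B := by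
    intro y
    have hop : IsOpen {z : ℝ | (z : AddCircle r) ∉ B \ {(y : AddCircle r)}} :=
      (hB.subset Set.sdiff_subset).isClosed.isOpen_compl.preimage (AddCircle.continuous_mk' r)
    obtain ⟨e, he, hb⟩ := Metric.isOpen_iff.1 hop y (fun h => h.2 rfl)
    -- Radius `e` avoids the other classes in `B`; radius `r` avoids the other representatives of
    -- the class of `y`.
    refine ⟨min e r, lt_min he hr, fun z hz hzy hzB => ?_⟩
    refine hb (show z ∈ Metric.ball y e from ?_) ⟨hzB, fun hq => hz ?_⟩
    · rw [Metric.mem_ball, Real.dist_eq]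
      exact hzy.trans_le (min_le_left _ _)
    · have h0 : ((z - y : ℝ) : AddCircle r) = 0 := by
        rw [AddCircle.coe_sub, sub_eq_zero]; exact hq
      obtain ⟨k, hk⟩ := (AddCircle.coe_eq_zero_iff r).1 h0
      have h2 : |(k : ℝ)| * r < 1 * r := by
        have := hzy.trans_le (min_le_right e r)
        rwa [← hk, zsmul_eq_mul, abs_mul, abs_of_pos hr, ← one_mul r, ← mul_assoc, mul_one] at this
      have h3 : |(k : ℝ)| < 1 := lt_of_mul_lt_mul_right h2 hr.le
      have h4 : k = 0 := by
        rw [← Int.abs_lt_one_iff]; exact_mod_cast h3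
      rw [h4, zero_smul] at hk
      linarith
  intro y
  obtain ⟨e, he, hb⟩ := key y
  constructor
  · obtain ⟨l, -, c, hF⟩ := h y (y + e) (by linarith) (fun z hz => hb z hz.1.ne' (by
      rw [abs_of_pos (by linarith [hz.1])]; linarith [hz.2]))
    exact ⟨l, c, mem_of_superset (Icc_mem_nhdsGE (by linarith)) hF⟩
  · obtain ⟨l, -, c, hF⟩ := h (y - e) y (by linarith) (fun z hz => hb z hz.2.ne (by
      rw [abs_of_neg (by linarith [hz.2])]; linarith [hz.1]))
    exact ⟨l, c, mem_of_superset (Icc_mem_nhdsLE (by linarith)) hF⟩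

/-! ### From local to global piecewise linearity -/

/-- The derivative is locally constant on a connected interval, hence a constant `m`; then `F z - m
* z` has zero derivative. Continuity adds the endpoints. -/
theorem exists_affine_on_Icc {F : ℝ → ℝ} (hF : Continuous F) {x y : ℝ} (hxy : x < y)
    (h : ∀ z ∈ Set.Ioo x y, AffineNear F (𝓝 z)) :
    ∃ m c : ℝ, ∀ z ∈ Set.Icc x y, F z = m * z + c := by
  have hd : ∀ z ∈ Set.Ioo x y, ∃ m, HasDerivAt F m z ∧ deriv F =ᶠ[𝓝 z] fun _ => m := by
    intro z hz
    obtain ⟨m, c, hm⟩ := h z hz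
    have aff : ∀ w, HasDerivAt (fun z => m * z + c) m w := fun w => by
      simpa using ((hasDerivAt_id w).const_mul m).add_const c
    refine ⟨m, (aff z).congr_of_eventuallyEq hm, ?_⟩
    filter_upwards [hm.eventually_nhds] with w hw
    exact ((aff w).congr_of_eventuallyEq hw).deriv
  obtain ⟨m, hm⟩ := isOpen_Ioo.exists_is_const_of_deriv_eq_zero (f := deriv F)
    (s := Set.Ioo x y) isPreconnected_Ioo
    (fun z hz => by
      obtain ⟨m, -, h2⟩ := hd z hz
      exact ((differentiableAt_const m).congr_of_eventuallyEq h2).differentiableWithinAt)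
    (fun z hz => by
      obtain ⟨m, -, h2⟩ := hd z hz
      rw [h2.deriv_eq]; simp)
  have hG : ∀ z ∈ Set.Ioo x y, HasDerivAt (fun z => F z - m * z) 0 z := by
    intro z hz
    obtain ⟨m', h1, -⟩ := hd z hz
    have : m' = m := by rw [← h1.deriv, hm z hz]
    subst this
    have h2 := h1.fun_sub ((hasDerivAt_id z).const_mul m')
    rwa [mul_one, sub_self] at h2
  obtain ⟨c, hc⟩ := isOpen_Ioo.exists_is_const_of_deriv_eq_zero (f := fun z => F z - m * z)
    (s := Set.Ioo x y) isPreconnected_Ioo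
    (fun z hz => (hG z hz).differentiableAt.differentiableWithinAt)
    (fun z hz => (hG z hz).deriv)
  refine ⟨m, c, fun z hz => ?_⟩
  have e : Set.EqOn F (fun z => m * z + c) (Set.Ioo x y) := fun w hw => by
    have := hc w hw
    simp only at this ⊢
    linarith
  have := e.closure hF (by fun_prop)
  rw [closure_Ioo hxy.ne] at this
  exact this hz

/-- One-sided affine germs isolate the break points, so a compact period contains finitely many;
quasi-periodicity makes the set of breaks invariant under translation by `r`. -/
theorem exists_affineOff_of_locallyPL {r : ℝ} (hr : 0 < r) {F : ℝ → ℝ} (hF : Continuous F)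
    (h : LocallyPL F) {d : ℝ} (hper : ∀ x, F (x + r) = F x + d) :
    ∃ B : Set (AddCircle r), B.Finite ∧ AffineOff Set.univ B F := by
  set S : Set ℝ := {x | ¬ AffineNear F (𝓝 x)} with hS
  have hshift : ∀ (x : ℝ) (k : ℤ), F (x + k * r) = F x + k * d := by
    intro x k
    induction k with
    | zero => simp
    | succ k ih =>
      rw [show x + ((k + 1 : ℤ) : ℝ) * r = (x + ((k : ℤ) : ℝ) * r) + r by push_cast; ring, hper, ih]
      push_cast; ring
    | pred k ih =>
      have := hper (x + ((-(k : ℤ) - 1 : ℤ) : ℝ) * r)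
      rw [show x + ((-(k : ℤ) - 1 : ℤ) : ℝ) * r + r = x + ((-(k : ℤ) : ℤ) : ℝ) * r by
        push_cast; ring, ih] at this
      push_cast at this ⊢
      linarith
  have hSper : ∀ (x : ℝ) (k : ℤ), x + k * r ∈ S → x ∈ S := by
    intro x k hx hn
    refine hx ?_
    have h1 : AffineNear (fun z => F (z + -(k * r))) (𝓝 (x + k * r)) := by
      refine hn.comp ⟨1, -(k * r), by simp⟩ ?_
      have : ContinuousAt (fun z : ℝ => z + -(k * r)) (x + k * r) := by fun_prop
      simpa [ContinuousAt] using this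
    obtain ⟨m, c, h1⟩ := h1.affine_comp 1 (k * d)
    refine ⟨m, c, ?_⟩
    filter_upwards [h1] with z hz
    rw [← hz, one_mul, ← hshift]
    ring_nf
  have hiso : ∀ x, {z | z ∈ S → z = x} ∈ 𝓝 x := by
    intro x
    have h1 : ∀ᶠ z in 𝓝[>] x, AffineNear F (𝓝 z) := by
      obtain ⟨m, c, hm⟩ := (h x).1.mono (nhdsWithin_mono x Set.Ioi_subset_Ici_self)
      filter_upwards [eventually_eventually_nhdsWithin.2 hm, self_mem_nhdsWithin] with z hz hxz
      rw [isOpen_Ioi.nhdsWithin_eq hxz] at hz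
      exact ⟨m, c, hz⟩
    have h2 : ∀ᶠ z in 𝓝[<] x, AffineNear F (𝓝 z) := by
      obtain ⟨m, c, hm⟩ := (h x).2.mono (nhdsWithin_mono x Set.Iio_subset_Iic_self)
      filter_upwards [eventually_eventually_nhdsWithin.2 hm, self_mem_nhdsWithin] with z hz hxz
      rw [isOpen_Iio.nhdsWithin_eq hxz] at hz
      exact ⟨m, c, hz⟩
    have h3 : ∀ᶠ z in 𝓝[≠] x, AffineNear F (𝓝 z) := by
      rw [← nhdsLT_sup_nhdsGT]
      exact ⟨h2, h1⟩
    filter_upwards [eventually_nhdsWithin_iff.1 h3] with z hz hzS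
    by_contra hne
    exact hzS (hz hne)
  obtain ⟨t, -, ht⟩ := (isCompact_Icc (a := (0 : ℝ)) (b := r)).elim_nhds_subcover
    (fun x => {z | z ∈ S → z = x}) (fun x _ => hiso x)
  have hfin : (S ∩ Set.Icc 0 r).Finite := by
    refine t.finite_toSet.subset fun z hz => ?_
    obtain ⟨x, hx, hzx⟩ := Set.mem_iUnion₂.1 (ht hz.2)
    rw [hzx hz.1]
    exact hx
  refine ⟨(fun x : ℝ => (x : AddCircle r)) '' (S ∩ Set.Icc 0 r), hfin.image _, ?_⟩
  intro x y hxy hz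
  obtain ⟨m, c, hmc⟩ := exists_affine_on_Icc hF hxy (fun z hzI => by
    by_contra hn
    -- A break at `z` is translated into the fundamental interval `[0, r]`.
    refine hz z hzI ⟨z + (-⌊z / r⌋ : ℤ) * r, ⟨?_, ?_, ?_⟩, ?_⟩
    · refine hSper _ ⌊z / r⌋ ?_
      have : z + ((-⌊z / r⌋ : ℤ) : ℝ) * r + (⌊z / r⌋ : ℝ) * r = z := by push_cast; ring
      rw [this]
      exact hn
    · have := (le_div_iff₀ hr).1 (Int.floor_le (z / r))
      push_cast
      linarith
    · have := (div_lt_iff₀ hr).1 (Int.lt_floor_add_one (z / r))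
      push_cast
      linarith
    · have h0 : ((((-⌊z / r⌋ : ℤ) : ℝ) * r : ℝ) : AddCircle r) = 0 :=
        (AddCircle.coe_eq_zero_iff r).2 ⟨-⌊z / r⌋, by rw [zsmul_eq_mul]⟩
      change ((z + ((-⌊z / r⌋ : ℤ) : ℝ) * r : ℝ) : AddCircle r) = z
      rw [AddCircle.coe_add, h0, add_zero])
  exact ⟨m, trivial, c, hmc⟩

/-! ### Lifts -/

/-- Uniqueness of lifts through the covering `ℝ → AddCircle s`: once shifted to agree at `0`, the
two lifts agree everywhere. -/
theorem exists_eq_add_of_coe_eq {s : ℝ} (hs : 0 < s) {F G : ℝ → ℝ} (hF : Continuous F)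
    (hG : Continuous G) (h : ∀ x, (F x : AddCircle s) = (G x : AddCircle s)) :
    ∃ d : ℝ, (d : AddCircle s) = 0 ∧ ∀ x, F x = G x + d := by
  have _i : Fact (0 < s) := ⟨hs⟩
  have h0 : ((F 0 - G 0 : ℝ) : AddCircle s) = 0 := by
    rw [AddCircle.coe_sub, h, sub_self]
  refine ⟨F 0 - G 0, h0, fun x => ?_⟩
  have := (AddCircle.isCoveringMap_coe s).eq_of_comp_eq (g₁ := F)
    (g₂ := fun x => G x + (F 0 - G 0)) hF (by fun_prop) (by
      funext x
      simp only [Function.comp, AddCircle.coe_add, h0, add_zero, h]) 0 (by ring)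
  exact congrFun this x

theorem exists_continuous_lift {s : ℝ} (hs : 0 < s) {f : ℝ → AddCircle s} (hf : Continuous f) :
    ∃ F : ℝ → ℝ, Continuous F ∧ ∀ x, f x = F x := by
  have _i : Fact (0 < s) := ⟨hs⟩
  obtain ⟨e, he⟩ := QuotientAddGroup.mk_surjective (f 0)
  obtain ⟨F, ⟨-, hF⟩, -⟩ := (AddCircle.isCoveringMap_coe s).existsUnique_continuousMap_lifts
    ⟨f, hf⟩ 0 e he
  exact ⟨F, F.continuous, fun x => (congrFun hF x).symm⟩

/-- Continuous lifts `F` of `f` and `G` of its inverse compose to lifts of the identity, that is, to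
translations; correcting `G` by the constant `d` makes it inverse to `F`. -/
theorem exists_isLift {r s : ℝ} (hr : 0 < r) (hs : 0 < s) (f : AddCircle r ≃ₜ AddCircle s) :
    ∃ F : ℝ ≃ₜ ℝ, IsLift f F := by
  obtain ⟨F, hF, hfF⟩ := exists_continuous_lift hs
    (f.continuous.comp (AddCircle.continuous_mk' r))
  obtain ⟨G, hG, hfG⟩ := exists_continuous_lift hr
    (f.symm.continuous.comp (AddCircle.continuous_mk' s))
  obtain ⟨d, hd, hGF⟩ := exists_eq_add_of_coe_eq hr (hG.comp hF) continuous_id (fun x => by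
    change ((G (F x) : ℝ) : AddCircle r) = x
    rw [← hfG (F x)]
    change f.symm (F x : ℝ) = _
    rw [← hfF x]
    exact f.symm_apply_apply _)
  obtain ⟨d', -, hFG⟩ := exists_eq_add_of_coe_eq hs (F := fun y => F (G y - d)) (G := id)
    (by fun_prop) continuous_id (fun y => by
    rw [← hfF (G y - d)]
    change f ((G y - d : ℝ) : AddCircle r) = y
    rw [AddCircle.coe_sub, hd, sub_zero, ← hfG y]
    exact f.apply_symm_apply _)
  have h1 : ∀ x, G (F x) - d = x := fun x => by
    have := hGF x
    simp only [Function.comp, id] at this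
    rw [this]; ring
  -- The left inverse is already exact, so evaluating the other composite at `F 0` kills its
  -- constant.
  have h2 : d' = 0 := by
    have := hFG (F 0)
    simp only [h1, id] at this
    linarith
  refine ⟨⟨⟨F, fun y => G y - d, h1, fun y => ?_⟩, hF, by fun_prop⟩, hfF⟩
  have := hFG y
  simpa [h2] using this

theorem IsLift.exists_add_period {r s : ℝ} (hs : 0 < s) {f : AddCircle r ≃ₜ AddCircle s}
    {F : ℝ ≃ₜ ℝ} (h : IsLift f F) : ∃ d, ∀ x, F (x + r) = F x + d := by
  obtain ⟨d, -, hd⟩ := exists_eq_add_of_coe_eq hs (F := fun x => F (x + r)) (G := F)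
    (by fun_prop) (by fun_prop) (fun x => by
      rw [← h (x + r), ← h x, AddCircle.coe_add_period])
  exact ⟨d, hd⟩

/-- A homeomorphism of the line which commutes with the translation by the period induces a
homeomorphism of the circle. -/
theorem exists_homeomorph_of_isPeriodic {r : ℝ} (F : ℝ ≃ₜ ℝ) (hF : ∀ x, F (x + r) = F x + r) :
    ∃ f : AddCircle r ≃ₜ AddCircle r, IsLift f F := by
  have hG : ∀ x, F.symm (x + r) = F.symm x + r := fun x => by
    rw [F.symm_apply_eq, hF, F.apply_symm_apply]
  have hp : ∀ F : ℝ → ℝ, (∀ x, F (x + r) = F x + r) →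
      Function.Periodic (fun x => (F x : AddCircle r)) r := fun F hF x => by
    simp only [hF, AddCircle.coe_add_period]
  have hc : ∀ (F : ℝ → ℝ) (hF : ∀ x, F (x + r) = F x + r), Continuous F →
      Continuous (hp F hF).lift := fun F hF h =>
    continuous_coinduced_dom.2 ((AddCircle.continuous_mk' r).comp h)
  refine ⟨⟨⟨(hp F hF).lift, (hp F.symm hG).lift, ?_, ?_⟩, hc _ hF F.continuous,
    hc _ hG F.symm.continuous⟩, fun x => rfl⟩
  · intro q
    obtain ⟨x, rfl⟩ := QuotientAddGroup.mk_surjective q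
    change ((F.symm (F x) : ℝ) : AddCircle r) = x
    rw [F.symm_apply_apply]
  · intro q
    obtain ⟨x, rfl⟩ := QuotientAddGroup.mk_surjective q
    change ((F (F.symm x) : ℝ) : AddCircle r) = x
    rw [F.apply_symm_apply]


/-! ### Elements of the Thompson-Stein groups -/

/-- The restriction to `[0, r]` of an increasing bijection of the line fixing `0` and `r` extends
to a homeomorphism of the line which commutes with the translation by `r`. -/
theorem exists_isPeriodic_of_fixes {r : ℝ} (hr : 0 < r) {F₀ : ℝ → ℝ} (hmono : StrictMono F₀)
    (hsurj : Function.Surjective F₀) (h0 : F₀ 0 = 0) (h1 : F₀ r = r) :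
    ∃ F : ℝ ≃ₜ ℝ, (∀ x, F (x + r) = F x + r) ∧
      ∀ (k : ℤ), ∀ x ∈ Set.Icc 0 r, F (x + k * r) = F₀ x + k * r := by
  -- Reduce to `[0, r)`, apply `F₀`, translate back. The pieces match at multiples of `r` because
  -- `F₀` fixes both `0` and `r`.
  set P : ℝ → ℝ := fun x => F₀ (x - ⌊x / r⌋ * r) + ⌊x / r⌋ * r with hP
  have hPI : ∀ (k : ℤ), ∀ x ∈ Set.Ico 0 r, P (x + k * r) = F₀ x + k * r := by
    intro k x hx
    have : ⌊(x + k * r) / r⌋ = k := by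
      rw [Int.floor_eq_iff, le_div_iff₀ hr, div_lt_iff₀ hr]
      constructor <;> nlinarith [hx.1, hx.2]
    simp only [hP, this]
    ring_nf
  have hdec : ∀ x : ℝ, ∃ k : ℤ, ∃ z ∈ Set.Ico 0 r, x = z + k * r := by
    intro x
    refine ⟨⌊x / r⌋, x - ⌊x / r⌋ * r, ⟨?_, ?_⟩, by ring⟩
    · linarith [(le_div_iff₀ hr).1 (Int.floor_le (x / r))]
    · linarith [(div_lt_iff₀ hr).1 (Int.lt_floor_add_one (x / r))]
  have hmem : ∀ z ∈ Set.Ico 0 r, F₀ z ∈ Set.Ico 0 r := fun z hz =>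
    ⟨h0 ▸ hmono.monotone hz.1, h1 ▸ hmono hz.2⟩
  have hPI' : ∀ (k : ℤ), ∀ x ∈ Set.Icc 0 r, P (x + k * r) = F₀ x + k * r := by
    intro k x hx
    rcases hx.2.eq_or_lt with rfl | h
    · have := hPI (k + 1) 0 ⟨le_rfl, hr⟩
      rw [h0] at this
      rw [h1, show x + k * x = 0 + (k + 1 : ℤ) * x by push_cast; ring, this]
    · exact hPI k x ⟨hx.1, h⟩
  have hPm : StrictMono P := by
    intro x y hxy
    obtain ⟨j, z, hz, rfl⟩ := hdec x
    obtain ⟨k, w, hw, rfl⟩ := hdec y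
    rw [hPI j z hz, hPI k w hw]
    rcases lt_trichotomy j k with h | rfl | h
    · have : (j : ℝ) + 1 ≤ k := by exact_mod_cast h
      nlinarith [(hmem z hz).2, (hmem w hw).1]
    · have := hmono (show z < w by linarith)
      linarith
    · have : (k : ℝ) + 1 ≤ j := by exact_mod_cast h
      nlinarith [hz.1, hw.2]
  have hPs : Function.Surjective P := by
    intro y
    obtain ⟨k, w, hw, rfl⟩ := hdec y
    obtain ⟨z, rfl⟩ := hsurj w
    refine ⟨z + k * r, hPI k z ⟨?_, ?_⟩⟩
    · rw [← hmono.le_iff_le, h0]; exact hw.1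
    · rw [← hmono.lt_iff_lt, h1]; exact hw.2
  refine ⟨(hPm.orderIsoOfSurjective P hPs).toHomeomorph, fun x => ?_, hPI'⟩
  change P (x + r) = P x + r
  obtain ⟨k, z, hz, rfl⟩ := hdec x
  rw [show z + k * r + r = z + (k + 1 : ℤ) * r by push_cast; ring, hPI _ z hz, hPI _ z hz]
  push_cast; ring

/-- An increasing piecewise linear bijection of the line with support `[0, (n + 1) L]`, with slope `n` on
`[0, L]` and `1 / n` on the rest of the support. -/
noncomputable def bump (n L : ℝ) (x : ℝ) : ℝ :=
  max x (min (n * x) (n⁻¹ * x + (n - n⁻¹) * L))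

section bump

variable {n L : ℝ}

/-- Maxima and minima of increasing affine maps are increasing, which is the advantage of the
formula over a definition by cases. -/
theorem bump_strictMono (hn : 1 < n) : StrictMono (bump n L) := by
  intro x y hxy
  have h1 : n * x < n * y := by nlinarith
  have h2 : n⁻¹ * x < n⁻¹ * y := mul_lt_mul_of_pos_left hxy (by positivity)
  exact max_lt_max hxy (min_lt_min h1 (by linarith))

theorem bump_of_nonpos (hn : 1 < n) {x : ℝ} (hx : x ≤ 0) : bump n L x = x :=
  max_eq_left ((min_le_left _ _).trans (by nlinarith))

theorem bump_of_le (hn : 1 < n) {x : ℝ} (hx : 0 ≤ x) (hxL : x ≤ L) : bump n L x = n * x := by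
  have h0 : 0 < n - n⁻¹ := by linarith [inv_lt_one_of_one_lt₀ hn]
  rw [bump, min_eq_left (by nlinarith), max_eq_right (by nlinarith)]

theorem bump_of_mid (hn : 1 < n) {x : ℝ} (hx : L ≤ x) (hxL : x ≤ (n + 1) * L) :
    bump n L x = n⁻¹ * x + (n - n⁻¹) * L := by
  have h0 : 0 < n - n⁻¹ := by linarith [inv_lt_one_of_one_lt₀ hn]
  rw [bump, min_eq_right (by nlinarith), max_eq_right]
  -- This factorization shows that the line of slope `n⁻¹` meets the diagonal at `(n + 1) * L`.
  have h1 : (n - n⁻¹) = (1 - n⁻¹) * (n + 1) := by field_simp; ring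
  have h2 : 0 < 1 - n⁻¹ := by linarith [inv_lt_one_of_one_lt₀ hn]
  rw [h1]
  nlinarith

theorem bump_of_ge (hn : 1 < n) {x : ℝ} (hxL : (n + 1) * L ≤ x) : bump n L x = x := by
  refine max_eq_left ((min_le_right _ _).trans ?_)
  have h1 : (n - n⁻¹) = (1 - n⁻¹) * (n + 1) := by field_simp; ring
  have h2 : 0 < 1 - n⁻¹ := by linarith [inv_lt_one_of_one_lt₀ hn]
  rw [h1]
  nlinarith

theorem bump_surjective (hn : 1 < n) : Function.Surjective (bump n L) := by
  refine Continuous.surjective (by unfold bump; fun_prop) ?_ ?_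
  · exact tendsto_atTop_mono (fun x => le_max_left _ _) tendsto_id
  · refine tendsto_id.congr' ?_
    filter_upwards [eventually_le_atBot 0] with x hx
    exact (bump_of_nonpos hn hx).symm

end bump

/-! ### Rotations and expansions in the Thompson-Stein group -/

variable {p : ℕ} {n : Fin p → ℕ}

theorem inv_mem_breakGroup (n : Fin p → ℕ) (i : Fin p) (k : ℕ) :
    ((n i : ℝ)⁻¹) ^ k ∈ breakGroup n :=
  Subalgebra.pow_mem (Algebra.adjoin ℤ (Set.range fun i => ((n i : ℝ))⁻¹))
    (Algebra.subset_adjoin ⟨i, rfl⟩) k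

theorem intCast_mul_natCast_mem_breakGroup (n : Fin p → ℕ) (k : ℤ) (r : ℕ) :
    (k : ℝ) * r ∈ breakGroup n := by
  have := (breakGroup n).zsmul_mem (natCast_mem_breakGroup n r) k
  rwa [zsmul_eq_mul] at this

/-- The powers of `1 / n i` are arbitrarily small positive elements. -/
theorem dense_breakGroup (i : Fin p) (hi : 1 < n i) : Dense (breakGroup n : Set ℝ) := by
  refine AddSubgroup.dense_of_not_isolated_zero _ fun ε hε => ?_
  have h1 : (1 : ℝ) < n i := by exact_mod_cast hi
  obtain ⟨k, hk⟩ := exists_pow_lt_of_lt_one hε (inv_lt_one_of_one_lt₀ h1)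
  exact ⟨_, inv_mem_breakGroup n i k, by positivity, hk⟩

theorem natCast_mem_slopeSet (i : Fin p) (hi : 1 < n i) :
    (n i : ℝ) ∈ Subtype.val '' (slopeGroup n : Set {x : ℝ // 0 < x}) :=
  ⟨⟨n i, by positivity⟩, Subgroup.subset_closure ⟨i, rfl⟩, rfl⟩

theorem inv_mem_slopeSet {l : ℝ} (hl : l ∈ Subtype.val '' (slopeGroup n : Set {x : ℝ // 0 < x})) :
    l⁻¹ ∈ Subtype.val '' (slopeGroup n : Set {x : ℝ // 0 < x}) := by
  obtain ⟨l, hl, rfl⟩ := hl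
  exact ⟨l⁻¹, (slopeGroup n).inv_mem hl, Positive.coe_inv l⟩

theorem one_mem_slopeSet :
    (1 : ℝ) ∈ Subtype.val '' (slopeGroup n : Set {x : ℝ // 0 < x}) :=
  ⟨1, (slopeGroup n).one_mem, rfl⟩

/-- Rotations by points of `breakGroup n` belong to the Thompson-Stein group. -/
theorem exists_rotation (r : ℕ) (hr : 0 < r) {a : ℝ} (ha : a ∈ breakGroup n) :
    ∃ g ∈ thompsonStein r hr n, IsLift g (Homeomorph.addRight a) := by
  obtain ⟨g, hg⟩ := exists_homeomorph_of_isPeriodic (r := r) (Homeomorph.addRight a)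
    (fun x => by simp only [Homeomorph.coe_addRight]; ring)
  refine ⟨g, ⟨_, hg, {0}, Set.finite_singleton _, rfl, fun x hx => ?_, fun x y _ _ =>
    ⟨1, one_mem_slopeSet, a, fun z _ => by simp⟩⟩, hg⟩
  rw [Set.mem_singleton_iff, AddCircle.coe_eq_zero_iff] at hx
  obtain ⟨k, rfl⟩ := hx
  rw [zsmul_eq_mul]
  have := intCast_mul_natCast_mem_breakGroup n k r
  exact ⟨this, (breakGroup n).add_mem this ha⟩

/-- The Thompson-Stein group has an element fixing `0`, with slope `n i` to the right of `0`. -/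
theorem exists_expansion (r : ℕ) (hr : 0 < r) (i : Fin p) (hi : 1 < n i) :
    ∃ g ∈ thompsonStein r hr n, ∃ F : ℝ ≃ₜ ℝ, IsLift g F ∧
      ∃ ε > 0, ∀ x ∈ Set.Icc 0 ε, F x = n i * x := by
  set N : ℝ := (n i : ℝ) with hN
  have hN2 : 2 ≤ N := by rw [hN]; exact_mod_cast hi
  have hN1 : 1 < N := by linarith
  have hr1 : (1 : ℝ) ≤ r := by exact_mod_cast hr
  have hr0 : (0 : ℝ) < r := by linarith
  -- With this `L` the breaks lie in `breakGroup n`, and the support fits in one period: `(N + 1) /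
  -- N ^ 2 < 1 ≤ r` because `N ≥ 2`.
  obtain ⟨L, hL⟩ : ∃ L : ℝ, L = N⁻¹ ^ 2 := ⟨_, rfl⟩
  have hL0 : 0 < L := by rw [hL]; positivity
  have hLA : L ∈ breakGroup n := hL ▸ inv_mem_breakGroup n i 2
  have hLr : (N + 1) * L < r := by
    have : (N + 1) * L < 1 := by
      rw [hL, inv_pow, ← div_eq_mul_inv, div_lt_one (by positivity)]
      nlinarith
    linarith
  have hLL : L < (N + 1) * L := by nlinarith
  have hNA : ∀ a ∈ breakGroup n, N * a ∈ breakGroup n := by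
    intro a ha
    have := (breakGroup n).nsmul_mem ha (n i)
    rwa [nsmul_eq_mul] at this
  have hKA : (N + 1) * L ∈ breakGroup n := by
    rw [add_mul, one_mul]
    exact (breakGroup n).add_mem (hNA L hLA) hLA
  have b0 : bump N L 0 = 0 := bump_of_nonpos hN1 le_rfl
  obtain ⟨F, hFp, hF⟩ := exists_isPeriodic_of_fixes hr0 (bump_strictMono (L := L) hN1)
    (bump_surjective hN1) b0 (bump_of_ge hN1 hLr.le)
  obtain ⟨g, hg⟩ := exists_homeomorph_of_isPeriodic F hFp
  refine ⟨g, ⟨F, hg, (fun x : ℝ => (x : AddCircle (r : ℝ))) '' {0, L, (N + 1) * L},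
    (Set.toFinite _).image _, ⟨0, by simp, by simp⟩, ?_, ?_⟩, F, hg, L, hL0, fun x hx => ?_⟩
  · rintro x ⟨b, hb, hbx⟩
    have hx : ∃ k : ℤ, x = b + k * r := by
      have : ((x - b : ℝ) : AddCircle (r : ℝ)) = 0 := by
        rw [AddCircle.coe_sub, sub_eq_zero]; exact hbx.symm
      obtain ⟨k, hk⟩ := (AddCircle.coe_eq_zero_iff _).1 this
      refine ⟨k, ?_⟩
      rw [zsmul_eq_mul] at hk
      linarith
    obtain ⟨k, rfl⟩ := hx
    have hkA := intCast_mul_natCast_mem_breakGroup n k r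
    have key : b ∈ Set.Icc (0 : ℝ) r ∧ b ∈ breakGroup n ∧ bump N L b ∈ breakGroup n := by
      rcases hb with rfl | rfl | rfl
      · exact ⟨⟨le_rfl, hr0.le⟩, zero_mem _, b0.symm ▸ zero_mem _⟩
      · refine ⟨⟨hL0.le, (hLL.trans hLr).le⟩, hLA, ?_⟩
        rw [bump_of_le hN1 hL0.le le_rfl]
        exact hNA _ hLA
      · refine ⟨⟨(hL0.trans hLL).le, hLr.le⟩, hKA, ?_⟩
        rwa [bump_of_ge hN1 le_rfl]
    rw [hF k b key.1]
    exact ⟨(breakGroup n).add_mem key.2.1 hkA, (breakGroup n).add_mem key.2.2 hkA⟩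
  · intro x y hxy hz
    obtain ⟨k, hk⟩ : ∃ k : ℤ, k = ⌊x / (r : ℝ)⌋ := ⟨_, rfl⟩
    have hk1 : k * (r : ℝ) ≤ x := by rw [hk]; exact (le_div_iff₀ hr0).1 (Int.floor_le _)
    have hk2 : x < (k + 1) * r := by
      rw [hk]; exact (div_lt_iff₀ hr0).1 (Int.lt_floor_add_one _)
    have hcoe : ∀ (b : ℝ) (j : ℤ), ((b + j * r : ℝ) : AddCircle (r : ℝ)) = b := fun b j => by
      rw [AddCircle.coe_add, (AddCircle.coe_eq_zero_iff (r : ℝ) (x := j * r)).2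
        ⟨j, zsmul_eq_mul _ _⟩, add_zero]
    have hav : ∀ b ∈ ({0, L, (N + 1) * L} : Set ℝ), ∀ j : ℤ, b + j * r ≤ x ∨ y ≤ b + j * r := by
      intro b hb j
      by_contra! h
      exact hz _ h ⟨b, hb, (hcoe b j).symm⟩
    -- Since `0` is a subdivision point, an interval avoiding the breaks stays within one period;
    -- its position relative to `L` and `(N + 1) * L` then selects the slope.
    have hy : y ≤ (k + 1) * r := by
      rcases hav 0 (by simp) (k + 1) with h | h <;> push_cast at h <;> linarith
    have hFz : ∀ z ∈ Set.Icc x y, F z = bump N L (z - k * r) + k * r := fun z hz => by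
      rw [← hF k _ ⟨by linarith [hz.1], by linarith [hz.2]⟩, sub_add_cancel]
    have hNs := natCast_mem_slopeSet i hi
    rcases hav L (by simp) k with h1 | h1
    · rcases hav ((N + 1) * L) (by simp) k with h2 | h2
      · refine ⟨1, one_mem_slopeSet, 0, fun z hz => ?_⟩
        rw [hFz z hz, bump_of_ge hN1 (by linarith [hz.1])]
        ring
      · refine ⟨N⁻¹, inv_mem_slopeSet hNs, (N - N⁻¹) * L + k * r - N⁻¹ * (k * r), fun z hz => ?_⟩
        rw [hFz z hz, bump_of_mid hN1 (by linarith [hz.1]) (by linarith [hz.2])]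
        ring
    · refine ⟨N, hNs, k * r - N * (k * r), fun z hz => ?_⟩
      rw [hFz z hz, bump_of_le hN1 (by linarith [hz.1]) (by linarith [hz.2])]
      ring
  · have := hF 0 x ⟨hx.1, hx.2.trans (hLL.trans hLr).le⟩
    simp only [Int.cast_zero, zero_mul, add_zero] at this
    rw [this, bump_of_le hN1 hx.1 hx.2]

/-- A conjugacy carries lifts of elements of the group to piecewise linear maps of the line. -/
theorem Conjugates.exists_locallyPL {r : ℕ} {hr : 0 < r}
    {h : AddCircle (r : ℝ) ≃ₜ AddCircle (1 : ℝ)} {φ : thompsonStein r hr n →* PLPlus 1 one_pos}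
    (hφ : Conjugates h φ) {H : ℝ ≃ₜ ℝ} (hH : IsLift h H)
    {g : AddCircle (r : ℝ) ≃ₜ AddCircle (r : ℝ)} (hg : g ∈ thompsonStein r hr n) {F : ℝ ≃ₜ ℝ}
    (hF : IsLift g F) : ∃ Φ : ℝ → ℝ, LocallyPL Φ ∧ ∀ x, Φ (H x) = H (F x) := by
  obtain ⟨Φ, hΦ, B, hB, hBΦ⟩ := (φ ⟨g, hg⟩).2
  -- `H ∘ F` and `Φ ∘ H` lift the same map `h ∘ g = φ g ∘ h`, so they differ by a constant, which is
  -- absorbed into `Φ`.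
  obtain ⟨d, -, hd⟩ := exists_eq_add_of_coe_eq one_pos (F := fun x => H (F x))
    (G := fun x => Φ (H x)) (by fun_prop) (by fun_prop) (fun x => by
      rw [← hΦ, ← hH, ← hH, hφ, h.symm_apply_apply, ← hF])
  refine ⟨_, (locallyPL_of_affineOff one_pos hB hBΦ).affine_comp 1 d, fun x => ?_⟩
  rw [one_mul]
  exact (hd x).symm


/-! ### Homogeneous functions near zero -/

/-- A function on a half-line with two incommensurable (quasi-)periods is constant. -/
theorem constant_of_periods {u : ℝ → ℝ} (hu : Continuous u) {p q β T : ℝ} (hp : 0 < p)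
    (hpq : Irrational (p / q)) (h1 : ∀ t ≤ T, u (t + p) = u t)
    (h2 : ∀ t ≤ T, u (t + q) = u t + β) : ∀ s ≤ T, ∀ t ≤ T, u s = u t := by
  have hback : ∀ (k : ℕ), ∀ t ≤ T, u (t - k * p) = u t := by
    intro k
    induction k with
    | zero => simp
    | succ k ih =>
      intro t ht
      have hkp : 0 ≤ k * p := by positivity
      have := h1 (t - (k + 1 : ℕ) * p) (by push_cast; linarith)
      rw [← ih t ht, ← this]
      push_cast
      ring_nf
  have hN : ∀ t : ℝ, ∃ k : ℕ, t - k * p ≤ T := fun t => by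
    obtain ⟨k, hk⟩ := exists_nat_ge ((t - T) / p)
    exact ⟨k, by linarith [(div_le_iff₀ hp).1 hk]⟩
  choose N hN using hN
  -- `V` extends `u` periodically to the whole line by sliding left into the half-line. The result
  -- does not depend on the number of steps, so `V` is continuous although `N` need not be.
  set V : ℝ → ℝ := fun t => u (t - N t * p) with hV
  have hVe : ∀ (t : ℝ) (k : ℕ), t - k * p ≤ T → V t = u (t - k * p) := by
    intro t k hk
    simp only [hV]
    rw [← hback k _ (hN t), ← hback (N t) _ hk]
    ring_nf
  have hVu : ∀ t ≤ T, V t = u t := fun t ht => by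
    rw [hVe t 0 (by simpa using ht)]
    simp
  have hVc : Continuous V := by
    refine continuous_iff_continuousAt.2 fun t => ?_
    have h : V =ᶠ[𝓝 t] fun s => u (s - N (t + 1) * p) := by
      filter_upwards [Iio_mem_nhds (lt_add_one t)] with s hs
      exact hVe s _ (by linarith [hN (t + 1), Set.mem_Iio.1 hs])
    exact ContinuousAt.congr (by fun_prop) h.symm
  have hVp : Function.Periodic V p := fun t => by
    have := hVe (t + p) (N t + 1) (by push_cast; linarith [hN t])
    rw [this]
    push_cast
    rw [hV]
    ring_nf
  have hVq : ∀ t, V (t + q) = V t + β := fun t => by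
    obtain ⟨k, hk⟩ := exists_nat_ge (max ((t + q - T) / p) ((t - T) / p))
    have k1 := (div_le_iff₀ hp).1 ((le_max_left _ _).trans hk)
    have k2 := (div_le_iff₀ hp).1 ((le_max_right _ _).trans hk)
    rw [hVe t k (by linarith), hVe (t + q) k (by linarith), ← h2 _ (by linarith)]
    ring_nf
  have hVqn : ∀ k : ℕ, V (k * q) = V 0 + k * β := fun k => by
    induction k with
    | zero => simp
    | succ k ih =>
      rw [show ((k + 1 : ℕ) : ℝ) * q = k * q + q by push_cast; ring, hVq, ih]
      push_cast; ring
  -- A continuous periodic function is bounded, whereas `V (k * q)` grows like `k * β`.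
  have hβ : β = 0 := by
    obtain ⟨M, hM⟩ := (hVp.isBounded_of_continuous hp.ne' hVc).exists_norm_le
    by_contra hne
    obtain ⟨k, hk⟩ := exists_nat_gt (2 * M / |β|)
    rw [div_lt_iff₀ (abs_pos.2 hne)] at hk
    have e1 := hM _ ⟨k * q, rfl⟩
    have e2 := hM _ ⟨0, rfl⟩
    have e3 : |(k : ℝ) * β| = k * |β| := by rw [abs_mul, Nat.abs_cast]
    have e4 : (k : ℝ) * β = V (k * q) - V 0 := by rw [hVqn]; ring
    rw [Real.norm_eq_abs] at e1 e2
    have := abs_sub (V (k * q)) (V 0)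
    rw [← e4, e3] at this
    linarith
  -- The periods of `V` form a closed subgroup; it contains `p` and `q`, so it is dense, hence
  -- everything.
  set Z : AddSubgroup ℝ :=
    { carrier := {c | ∀ t, V (t + c) = V t}
      zero_mem' := fun t => by rw [add_zero]
      add_mem' := fun {a b} ha hb t => by rw [← add_assoc, hb, ha]
      neg_mem' := fun {a} ha t => by rw [← ha (t + -a), neg_add_cancel_right] } with hZ
  have hZc : IsClosed (Z : Set ℝ) := by
    have : (Z : Set ℝ) = ⋂ t, {c | V (t + c) = V t} := by
      ext c; simp [hZ]
    rw [this]
    exact isClosed_iInter fun t => isClosed_eq (by fun_prop) (by fun_prop)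
  have hZd : Dense (Z : Set ℝ) := by
    refine (dense_addSubgroupClosure_pair_iff.2 hpq).mono ?_
    rw [SetLike.coe_subset_coe, AddSubgroup.closure_le]
    rintro c (rfl | rfl)
    · exact hVp
    · intro t
      rw [hVq, hβ, add_zero]
  have hall : ∀ c, c ∈ Z := fun c => by
    have := hZd.closure_eq ▸ Set.mem_univ c
    rwa [hZc.closure_eq] at this
  intro s hs t ht
  rw [← hVu s hs, ← hVu t ht]
  have := hall (s - t) t
  rwa [add_sub_cancel] at this

/-- A continuous positive function which is homogeneous near `0` under two multiplicatively
independent dilations is a power function near `0`. -/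
theorem eq_rpow_of_homogeneous {K : ℝ → ℝ} (hK : Continuous K) (hpos : ∀ x, 0 < x → 0 < K x)
    {a b μ ν ε : ℝ} (ha : 1 < a) (hb : 0 < b) (hab : Irrational (Real.log a / Real.log b))
    (hε : 0 < ε) (h1 : ∀ x, 0 < x → x ≤ ε → K (a * x) = μ * K x)
    (h2 : ∀ x, 0 < x → x ≤ ε → K (b * x) = ν * K x) :
    ∃ C α : ℝ, ∀ x, 0 < x → x ≤ ε → K x = C * x ^ α := by
  have ha0 : 0 < a := by linarith
  have hμ : 0 < μ := by
    have := h1 ε hε le_rfl ▸ hpos _ (mul_pos ha0 hε)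
    exact (pos_iff_pos_of_mul_pos this).2 (hpos ε hε)
  have hν : 0 < ν := by
    have := h2 ε hε le_rfl ▸ hpos _ (mul_pos hb hε)
    exact (pos_iff_pos_of_mul_pos this).2 (hpos ε hε)
  have hla : 0 < Real.log a := Real.log_pos ha
  obtain ⟨α, hα⟩ : ∃ α, α = Real.log μ / Real.log a := ⟨_, rfl⟩
  have hαa : α * Real.log a = Real.log μ := by rw [hα]; field_simp
  -- The choice of `α` makes `log a` an exact period of `u`; `log b` is then a period up to an
  -- additive constant.
  set u : ℝ → ℝ := fun t => Real.log (K (Real.exp t)) - α * t with hu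
  have huc : Continuous u := by
    refine Continuous.sub ?_ (by fun_prop)
    exact (hK.comp Real.continuous_exp).log fun t => (hpos _ (Real.exp_pos t)).ne'
  have hle : ∀ t ≤ Real.log ε, Real.exp t ≤ ε := fun t ht => (Real.le_log_iff_exp_le hε).1 ht
  have hshift : ∀ (c l : ℝ), 0 < c → 0 < l → (∀ x, 0 < x → x ≤ ε → K (c * x) = l * K x) →
      ∀ t ≤ Real.log ε, u (t + Real.log c) = u t + (Real.log l - α * Real.log c) := by
    intro c l hc hl h t ht
    simp only [hu]
    rw [Real.exp_add, Real.exp_log hc, mul_comm (Real.exp t), h _ (Real.exp_pos t) (hle t ht),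
      Real.log_mul hl.ne' (hpos _ (Real.exp_pos t)).ne']
    ring
  have hconst := constant_of_periods huc (T := Real.log ε) hla hab
    (fun t ht => by rw [hshift a μ ha0 hμ h1 t ht, hαa, sub_self, add_zero])
    (hshift b ν hb hν h2)
  refine ⟨Real.exp (u (Real.log ε)), α, fun x hx hxε => ?_⟩
  have := hconst (Real.log x) (Real.log_le_log hx hxε) (Real.log ε) le_rfl
  rw [← this]
  simp only [hu]
  rw [Real.exp_log hx, Real.exp_sub, Real.exp_log (hpos x hx), Real.rpow_def_of_pos hx,
    mul_comm (Real.log x), div_mul_cancel₀ _ (Real.exp_ne_zero _)]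

/-- A power function is an affine function of one of its translates only if it is linear. -/
theorem exponent_eq_one {α a l c δ : ℝ} (ha : 0 < a) (hα : α ≠ 0) (hδ : 0 < δ)
    (h : ∀ x, 0 < x → x < δ → (x + a) ^ α = l * x ^ α + c) : α = 1 := by
  have hder : ∀ x, 0 < x → x < δ → (x + a) ^ (α - 1) = l * x ^ (α - 1) := by
    intro x hx hxδ
    have d1 : HasDerivAt (fun x => (x + a) ^ α) (1 * α * (x + a) ^ (α - 1)) x :=
      ((hasDerivAt_id x).add_const a).rpow_const (Or.inl (by simp only [id]; linarith))
    have d2 : HasDerivAt (fun x => l * x ^ α + c) (l * (α * x ^ (α - 1))) x :=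
      ((Real.hasDerivAt_rpow_const (Or.inl hx.ne')).const_mul l).add_const c
    have d3 := (d2.congr_of_eventuallyEq (by
      filter_upwards [Ioo_mem_nhds hx hxδ] with z hz using h z hz.1 hz.2)).unique d1
    have : α * (l * x ^ (α - 1)) = α * (x + a) ^ (α - 1) := by linarith
    exact (mul_left_cancel₀ hα this).symm
  -- The base `(x + a) / x` varies with `x`, so a constant power means exponent `0`; two sample
  -- points are enough.
  have hq : ∀ x, 0 < x → x < δ → ((x + a) / x) ^ (α - 1) = l := by
    intro x hx hxδ
    rw [Real.div_rpow (by linarith) hx.le, hder x hx hxδ,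
      mul_div_cancel_right₀ _ (Real.rpow_pos_of_pos hx _).ne']
  by_contra hne
  have e := (hq (δ / 2) (by linarith) (by linarith)).trans
    (hq (δ / 3) (by linarith) (by linarith)).symm
  have e' := Real.rpow_left_injOn (sub_ne_zero.2 hne)
    (show 0 ≤ (δ / 2 + a) / (δ / 2) by positivity)
    (show 0 ≤ (δ / 3 + a) / (δ / 3) by positivity) e
  rw [div_eq_div_iff (by positivity) (by positivity)] at e'
  nlinarith [mul_pos ha hδ]

theorem AffineNear.exists_mul_sub {Φ : ℝ → ℝ} {y : ℝ} (h : AffineNear Φ (𝓝[≥] y)) :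
    ∃ m, ∀ᶠ z in 𝓝[≥] y, Φ z = Φ y + m * (z - y) := by
  obtain ⟨m, c, h⟩ := h
  refine ⟨m, ?_⟩
  have hy := h.self_of_nhdsWithin Set.self_mem_Ici
  filter_upwards [h] with z hz
  rw [hz, hy]
  ring

/-! ### Rigidity of the conjugacy -/

/-- An increasing homeomorphism of the line that semiconjugates a dense group of translations and
two independent dilations near `0` to piecewise linear maps is itself piecewise linear. -/
theorem locallyPL_of_semiconj_of_strictMono {H : ℝ ≃ₜ ℝ} (hm : StrictMono H) {A : AddSubgroup ℝ}
    (hA : Dense (A : Set ℝ))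
    (hrot : ∀ a ∈ A, ∃ Φ : ℝ → ℝ, LocallyPL Φ ∧ ∀ x, Φ (H x) = H (x + a))
    {a b : ℝ} (ha : 1 < a) (hb : 0 < b) (hab : Irrational (Real.log a / Real.log b))
    (hdil : ∀ c ∈ ({a, b} : Set ℝ), ∃ Φ : ℝ → ℝ, LocallyPL Φ ∧
      ∀ᶠ x in 𝓝[≥] 0, Φ (H x) = H (c * x)) : LocallyPL H := by
  have htend : ∀ x, Tendsto H (𝓝[≥] x) (𝓝[≥] (H x)) := fun x =>
    H.continuous.continuousWithinAt.tendsto_nhdsWithin fun z hz => hm.monotone hz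
  have htend' : ∀ x, Tendsto H (𝓝[≤] x) (𝓝[≤] (H x)) := fun x =>
    H.continuous.continuousWithinAt.tendsto_nhdsWithin fun z hz => hm.monotone hz
  set K : ℝ → ℝ := fun x => H x - H 0 with hK
  have hKpos : ∀ x, 0 < x → 0 < K x := fun x hx => sub_pos.2 (hm hx)
  -- The dilation fixes `0`, so `Φ` fixes `H 0`, and its right slope there is the multiplier `μ`.
  have hhom : ∀ c ∈ ({a, b} : Set ℝ), ∃ μ, ∀ᶠ x in 𝓝[≥] 0, K (c * x) = μ * K x := by
    intro c hc
    obtain ⟨Φ, hΦ, hΦH⟩ := hdil c hc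
    obtain ⟨m, hm⟩ := (hΦ (H 0)).1.exists_mul_sub
    have h0 := hΦH.self_of_nhdsWithin Set.self_mem_Ici
    rw [mul_zero] at h0
    refine ⟨m, ?_⟩
    filter_upwards [hΦH, (htend 0).eventually hm] with x h1 h2
    simp only [hK]
    rw [← h1, h2, h0]
    ring
  obtain ⟨μ, hμ⟩ := hhom a (by simp)
  obtain ⟨ν, hν⟩ := hhom b (by simp)
  obtain ⟨ε, hε, hεK⟩ := mem_nhdsGE_iff_exists_Icc_subset.1 (hμ.and hν)
  have hε : 0 < ε := hε
  obtain ⟨C, α, hCα⟩ := eq_rpow_of_homogeneous (K := K) (by fun_prop) hKpos ha hb hab hε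
    (fun x h0 h1 => (hεK ⟨h0.le, h1⟩).1) (fun x h0 h1 => (hεK ⟨h0.le, h1⟩).2)
  have hC : C ≠ 0 := fun h => by
    have := hCα ε hε le_rfl
    rw [h, zero_mul] at this
    exact (hKpos ε hε).ne' this
  have hα0 : α ≠ 0 := fun h => by
    have e1 := hCα ε hε le_rfl
    have e2 := hCα (ε / 2) (by linarith) (by linarith)
    rw [h, Real.rpow_zero] at e1 e2
    have : H ε = H (ε / 2) := by
      have := e1.trans e2.symm
      simp only [hK] at this
      linarith
    have := H.injective this
    linarith
  have hα : α = 1 := by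
    obtain ⟨t, ht, ht0, htε⟩ := hA.exists_between hε
    obtain ⟨Φ, hΦ, hΦH⟩ := hrot t ht
    obtain ⟨m, hm⟩ := (hΦ (H 0)).1.exists_mul_sub
    obtain ⟨δ, hδ, hδK⟩ := mem_nhdsGE_iff_exists_Icc_subset.1 ((htend 0).eventually hm)
    have hδ : 0 < δ := hδ
    -- Near `0` on the right, `H (x + t) = Φ (H x) = H t + m * K x`. The bound `ε - t` keeps `x + t`
    -- where the power law holds; dividing by `C` gives the affine relation.
    refine exponent_eq_one (a := t) (l := m) (c := t ^ α) (δ := min δ (ε - t)) ht0 hα0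
      (lt_min hδ (by linarith)) (fun x hx hxδ => ?_)
    have x1 := hxδ.trans_le (min_le_left _ _)
    have x2 := hxδ.trans_le (min_le_right _ _)
    have e := hδK ⟨hx.le, x1.le⟩
    simp only [Set.mem_ofPred_eq, hΦH, zero_add] at e
    have k1 := hCα (x + t) (by linarith) (by linarith)
    have k2 := hCα x hx (by linarith)
    have k3 := hCα t ht0 htε.le
    simp only [hK] at k1 k2 k3
    rw [k2] at e
    refine mul_left_cancel₀ hC ?_
    rw [← k1, mul_add, ← k3]
    linear_combination e
  subst hα
  have haff : ∀ w ∈ Set.Ioo 0 ε, AffineNear H (𝓝 w) := by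
    intro w hw
    refine ⟨C, H 0, ?_⟩
    filter_upwards [Ioo_mem_nhds hw.1 hw.2] with z hz
    have := hCα z hz.1 hz.2.le
    simp only [hK, Real.rpow_one] at this
    linarith
  intro y
  -- The translate `y + t` lies in `(0, ε)`, where `H` is affine. Near `y`, `H x = Φ (H (x + t))`,
  -- and `Φ` may break at `H (y + t)`, so only one-sided germs are affine.
  obtain ⟨t, ht, ht1, ht2⟩ := hA.exists_between (show -y < ε - y by linarith)
  obtain ⟨Φ, hΦ, hΦH⟩ := hrot (-t) (A.neg_mem ht)
  have e : (H : ℝ → ℝ) = fun x => Φ (H (x + t)) := by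
    funext x
    rw [hΦH, add_neg_cancel_right]
  have hsh : ContinuousAt (fun x : ℝ => x + t) y := by fun_prop
  have hy : AffineNear (fun x => H (x + t)) (𝓝 y) :=
    (haff (y + t) ⟨by linarith, by linarith⟩).comp ⟨1, t, by simp⟩ hsh
  constructor
  · rw [e]
    refine (hΦ (H (y + t))).1.comp (hy.mono nhdsWithin_le_nhds) ((htend _).comp ?_)
    exact hsh.continuousWithinAt.tendsto_nhdsWithin fun z hz => add_le_add_left hz t
  · rw [e]
    refine (hΦ (H (y + t))).2.comp (hy.mono nhdsWithin_le_nhds) ((htend' _).comp ?_)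
    exact hsh.continuousWithinAt.tendsto_nhdsWithin fun z hz => add_le_add_left hz t

/-- A decreasing `H` is replaced by `-H`, with each `Φ` conjugated to `z ↦ -Φ (-z)`. -/
theorem locallyPL_of_semiconj {H : ℝ ≃ₜ ℝ} {A : AddSubgroup ℝ} (hA : Dense (A : Set ℝ))
    (hrot : ∀ a ∈ A, ∃ Φ : ℝ → ℝ, LocallyPL Φ ∧ ∀ x, Φ (H x) = H (x + a))
    {a b : ℝ} (ha : 1 < a) (hb : 0 < b) (hab : Irrational (Real.log a / Real.log b))
    (hdil : ∀ c ∈ ({a, b} : Set ℝ), ∃ Φ : ℝ → ℝ, LocallyPL Φ ∧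
      ∀ᶠ x in 𝓝[≥] 0, Φ (H x) = H (c * x)) : LocallyPL H := by
  rcases H.continuous.strictMono_of_inj H.injective with hm | hm
  · exact locallyPL_of_semiconj_of_strictMono hm hA hrot ha hb hab hdil
  have hneg : ∀ Φ : ℝ → ℝ, LocallyPL Φ → LocallyPL fun x => - Φ (-x) := fun Φ h => by
    simpa using h.comp_neg.affine_comp (-1) 0
  have := locallyPL_of_semiconj_of_strictMono (H := H.trans (Homeomorph.neg ℝ))
    (fun x y h => neg_lt_neg (hm h)) hA
    (fun t ht => by
      obtain ⟨Φ, h1, h2⟩ := hrot t ht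
      exact ⟨_, hneg Φ h1, fun x => by simp [h2]⟩) ha hb hab
    (fun c hc => by
      obtain ⟨Φ, h1, h2⟩ := hdil c hc
      exact ⟨_, hneg Φ h1, h2.mono fun x hx => by simp [hx]⟩)
  simpa using this.affine_comp (-1) 0

theorem irrational_div_of_linearIndependent {ι : Type*} {v : ι → ℝ} (h : LinearIndependent ℚ v)
    {i j : ι} (hij : i ≠ j) : Irrational (v i / v j) := by
  rintro ⟨q, hq⟩
  have hj : v j ≠ 0 := h.ne_zero j
  have hp : LinearIndependent ℚ ![v i, v j] := by
    have := h.comp ![i, j] (by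
      intro a b hab
      fin_cases a <;> fin_cases b <;> simp_all [eq_comm])
    convert this using 1
    ext a
    fin_cases a <;> rfl
  have e : (1 : ℚ) • v i + (-q) • v j = 0 := by
    rw [one_smul, neg_smul, Rat.smul_def, hq, div_mul_cancel₀ _ hj, add_neg_cancel]
  exact one_ne_zero (LinearIndependent.pair_iff.1 hp _ _ e).1

end ThompsonStein

/-! ### The main theorem -/

theorem mainTheorem4 (r : ℕ) (hr : 0 < r) (p : ℕ) (hp : 3 ≤ p) (n : Fin p → ℕ)
    (hn : ∀ i, 1 < n i) (hmono : StrictMono n)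
    (hind : LinearIndependent ℚ (fun i => Real.log (n i)))
    (φ : ThompsonStein.thompsonStein r hr n →* ThompsonStein.PLPlus 1 one_pos)
    (hφ : ∃ h : AddCircle (r : ℝ) ≃ₜ AddCircle (1 : ℝ), ThompsonStein.Conjugates h φ) :
    ∃ h : AddCircle (r : ℝ) ≃ₜ AddCircle (1 : ℝ),
      ThompsonStein.IsPL h ∧ ThompsonStein.Conjugates h φ := by
  open ThompsonStein in
  obtain ⟨h, hφ⟩ := hφ
  have hr0 : (0 : ℝ) < r := by exact_mod_cast hr
  obtain ⟨H, hH⟩ := exists_isLift hr0 one_pos h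
  obtain ⟨d, hd⟩ := hH.exists_add_period one_pos
  have hn' : ∀ i, (1 : ℝ) < n i := fun i => by exact_mod_cast hn i
  let i : Fin p := ⟨0, by omega⟩
  let j : Fin p := ⟨1, by omega⟩
  have hdil : ∀ k, ∃ Φ : ℝ → ℝ, LocallyPL Φ ∧ ∀ᶠ x in nhdsWithin 0 (Set.Ici 0),
      Φ (H x) = H (n k * x) := by
    intro k
    obtain ⟨g, hg, F, hF, ε, hε, hFε⟩ := exists_expansion (n := n) r hr k (hn k)
    obtain ⟨Φ, h1, h2⟩ := hφ.exists_locallyPL hH hg hF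
    refine ⟨Φ, h1, ?_⟩
    filter_upwards [Icc_mem_nhdsGE hε] with x hx
    rw [h2, hFε x hx]
  -- The topological conjugacy itself serves as the PL one; only local piecewise linearity of its
  -- lift remains.
  refine ⟨h, ⟨H, hH, exists_affineOff_of_locallyPL hr0 H.continuous ?_ hd⟩, hφ⟩
  refine locallyPL_of_semiconj (dense_breakGroup i (hn i)) (fun a ha => ?_) (hn' i)
    (zero_lt_one.trans (hn' j)) (irrational_div_of_linearIndependent hind
      (show i ≠ j from by simp [i, j])) ?_
  · obtain ⟨g, hg, hF⟩ := exists_rotation (n := n) r hr ha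
    exact hφ.exists_locallyPL hH hg hF
  · rintro c (rfl | rfl)
    · exact hdil i
    · exact hdil j
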